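/- Let $p\ge q$ and $m$ be nonnegative integers, let $A:\mathbf{R}^{p\times q}\to\mathbf{R}^m$ be linear, let $\phi$ be a norm on $\mathbf{R}^m$, and let $s$ be a nonnegative integer. Let $\sigma_1(z)\ge\sigma_2(z)\ge\dots\ge\sigma_q(z)$ be the singular values of $z\in\mathbf{R}^{p\times q}$, put $\sigma_i(z)=0$ for $i>q$, and let $\Sigma_k(z)=\sum_{i=1}^k\sigma_i(z)$ and $\|z\|=\sum_{i=1}^q\sigma_i(z)$ (the nuclear norm). Let $\mathcal P_s$ be the family of maps $P(z)=P_{\rm left}\,z\,P_{\rm right}$, where $P_{\rm left}\in\mathbf{R}^{p\times p}$ and $P_{\rm right}\in\mathbf{R}^{q\times q}$ are orthoprojectors of rank at most $s$ (each map is considered together with its pair $(P_{\rm left},P_{\rm right})$); with such a $P$ associate $\overline P(z)=(I_p-P_{\rm left})\,z\,(I_q-P_{\rm right})$. For $\gamma\ge0$ and $\beta\in[0,\infty]$ (with $\infty\cdot0=0$) consider the conditions $\mathbf C_s(\gamma,\beta;\phi)$: $\|P(z)\|+\|z\|-\|\overline P(z)\|\le\beta\phi(Az)+\gamma\|z\|$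 for all $z\in\mathbf{R}^{p\times q}$ and $P\in\mathcal P_s$; $\mathbf C^+_s(\gamma,\beta;\phi)$: there is a seminorm $\pi$ on $\mathbf{R}^{p\times q}$ such that, for all $z\in\mathbf{R}^{p\times q}$, (a) $\|P(z)\|+\|z\|-\|\overline P(z)\|\le\pi(z)$ for all $P\in\mathcal P_s$, and (b) $\pi(z)\le\beta\phi(Az)+\gamma\|z\|$. Then: 1. $\pi(z)=\Sigma_s(z)+\Sigma_{2s}(z)$ is a seminorm on $\mathbf{R}^{p\times q}$ (a norm if $s\ge1$), and it satisfies (a). 2. For all $\gamma\ge0$ and $\beta\in[0,\infty]$, the condition $$\Sigma_s(z)+\Sigma_{2s}(z)\le\beta\phi(Az)+\gamma\|z\|\quad\text{for all }z\in\mathbf{R}^{p\times q}\qquad(*)$$ implies $\mathbf C^+_s(\gamma,\beta;\phi)$ and $\mathbf C_s(\gamma,\beta;\phi)$. 3. If $(*)$ holds with some $0\le\gamma<1$ and $\beta\in[0,\infty]$, then $A$ is $s$-good: whenever $x\in\mathbf{R}^{p\times q}$ satisfies $P(x)=x$ for some $P\in\mathcal P_s$, the matrix $x$ is the unique minimizer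 of $\|u\|$ over $\{u\in\mathbf{R}^{p\times q}:\phi(Au-Ax)\le0\}$. 4. Let $(*)$ hold with some $0\le\gamma<1$ and $\beta<\infty$. Let $x,\widehat x\in\mathbf{R}^{p\times q}$, $\xi\in\mathbf{R}^m$, $y=Ax+\xi$, and let $\|x-P(x)\|\le\delta_x$ for some $P\in\mathcal P_s$. (i) If $\phi(\xi)\le\epsilon$, $\delta_x,\delta_\phi,\delta\ge0$, $\phi(A\widehat x-y)\le\epsilon+\delta_\phi$ and $\|\widehat x\|\le\inf_u\{\|u\|:\phi(Au-y)\le\epsilon\}+\delta$, then $$\|\widehat x-x\|\le\frac{\beta(2\epsilon+\delta_\phi)+\delta+2\delta_x}{1-\gamma}.$$ (ii) If $\lambda>0$, $\lambda\ge\beta$ and $\lambda\phi(A\widehat x-y)+\|\widehat x\|\le\inf_u\{\lambda\phi(Au-y)+\|u\|\}+\delta$, then $$\|\widehat x-x\|\le\frac{2\delta_x+\delta+2\lambda\phi(\xi)}{1-\gamma}.$$ -/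

import Mathlib

open scoped ENNReal

noncomputable section

/-- The data of a sparsity structure on `E`: a norm, and a family `(P i)` of projectors of `E`, where
each `P i` is assigned a linear map `Pbar i` and a weight `weight i`. -/
structure SparsityData (ι E : Type*) [AddCommGroup E] [Module ℝ E] where
  norm : E → ℝ
  P : ι → E →ₗ[ℝ] E
  Pbar : ι → E →ₗ[ℝ] E
  weight : ι → ℝ

namespace SparsityData

variable {ι X E Y : Type*} [AddCommGroup X] [Module ℝ X] [AddCommGroup E] [Module ℝ E]
  [AddCommGroup Y] [Module ℝ Y]

/-- The (indices of) members of the family of weight at most `s`. -/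
def level (S : SparsityData ι E) (s : ℝ) : Set ι := {i | S.weight i ≤ s}

/-- `w` is `s`-sparse: it is fixed by a projector of weight at most `s`. -/
def IsSparse (S : SparsityData ι E) (s : ℝ) (w : E) : Prop := ∃ i ∈ S.level s, S.P i w = w

/-- A seminorm `N` on `E` dominates `‖P B z‖ + ‖B z‖ - ‖Pbar B z‖` for all `z` and all projectors `P`
of weight at most `s`. -/
def Dominates (S : SparsityData ι E) (B : X →ₗ[ℝ] E) (s : ℝ) (N : Seminorm ℝ E) : Prop :=
  ∀ z : X, ∀ i ∈ S.level s,
    S.norm (S.P i (B z)) + S.norm (B z) - S.norm (S.Pbar i (B z)) ≤ N (B z)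

/-- The bound `f z ≤ β φ(A z) + γ ‖B z‖` for all `z`. Here `β` may be infinite, and `∞ * 0 = 0`. -/
def Bounded (S : SparsityData ι E) (A : X →ₗ[ℝ] Y) (B : X →ₗ[ℝ] E) (φ : Seminorm ℝ Y)
    (γ : ℝ) (β : ℝ≥0∞) (f : X → ℝ) : Prop :=
  ∀ z : X, ((f z : ℝ) : EReal) ≤
    (β : EReal) * ((φ (A z) : ℝ) : EReal) + ((γ * S.norm (B z) : ℝ) : EReal)

/-- The condition `C_s(γ, β; φ)`. -/
def Cond (S : SparsityData ι E) (A : X →ₗ[ℝ] Y) (B : X →ₗ[ℝ] E) (φ : Seminorm ℝ Y)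
    (s γ : ℝ) (β : ℝ≥0∞) : Prop :=
  ∀ i ∈ S.level s, S.Bounded A B φ γ β
    fun z => S.norm (S.P i (B z)) + S.norm (B z) - S.norm (S.Pbar i (B z))

/-- The condition `C_s⁺(γ, β; φ)`. -/
def CondPlus (S : SparsityData ι E) (A : X →ₗ[ℝ] Y) (B : X →ₗ[ℝ] E) (φ : Seminorm ℝ Y)
    (s γ : ℝ) (β : ℝ≥0∞) : Prop :=
  ∃ N : Seminorm ℝ E, S.Dominates B s N ∧ S.Bounded A B φ γ β fun z => N (B z)

/-- The feasible set of the regular recovery from the observation `y` at noise level `ε`. -/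
def feasible (A : X →ₗ[ℝ] Y) (φ : Seminorm ℝ Y) (ε : ℝ) (y : Y) : Set X :=
  {u | φ (A u - y) ≤ ε}

/-- The solutions of the regular recovery: the minimizers of `‖B u‖` over the feasible set. -/
def regArgmin (S : SparsityData ι E) (A : X →ₗ[ℝ] Y) (B : X →ₗ[ℝ] E) (φ : Seminorm ℝ Y)
    (ε : ℝ) (y : Y) : Set X :=
  {u | u ∈ feasible A φ ε y ∧ ∀ v ∈ feasible A φ ε y, S.norm (B u) ≤ S.norm (B v)}

/-- `A` is `s`-good: for every `s`-sparse signal `x`, the noiseless regular recovery from `A x` is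
solvable and every solution reproduces `B x` exactly. -/
def IsGood (S : SparsityData ι E) (A : X →ₗ[ℝ] Y) (B : X →ₗ[ℝ] E) (φ : Seminorm ℝ Y)
    (s : ℝ) : Prop :=
  ∀ x : X, S.IsSparse s (B x) → B '' S.regArgmin A B φ 0 (A x) = {B x}

/-- The optimal value of the regular recovery problem. -/
def regOpt (S : SparsityData ι E) (A : X →ₗ[ℝ] Y) (B : X →ₗ[ℝ] E) (φ : Seminorm ℝ Y)
    (ε : ℝ) (y : Y) : ℝ :=
  sInf ((fun u => S.norm (B u)) '' feasible A φ ε y)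

/-- The optimal value of the penalized recovery problem with penalty parameter `lam`. -/
def penOpt (S : SparsityData ι E) (A : X →ₗ[ℝ] Y) (B : X →ₗ[ℝ] E) (φ : Seminorm ℝ Y)
    (lam : ℝ) (y : Y) : ℝ :=
  ⨅ u : X, (lam * φ (A u - y) + S.norm (B u))

end SparsityData

/-- The sum of the `k` largest singular values of `z` (all of them when `k` is at least the number
of columns). -/
def kyFan {p q : ℕ} (k : ℕ) (z : Matrix (Fin p) (Fin q) ℝ) : ℝ :=
  ∑ i ∈ Finset.range k, (Matrix.toEuclideanLin z).singularValues i

/-- The nuclear norm: the sum of all singular values. -/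
def nuclearNorm {p q : ℕ} (z : Matrix (Fin p) (Fin q) ℝ) : ℝ :=
  ∑ j ∈ Finset.range q, (Matrix.toEuclideanLin z).singularValues j

/-- The linear map `x ↦ L x R` on matrices. -/
def sandwich {p q : ℕ} (L : Matrix (Fin p) (Fin p) ℝ) (R : Matrix (Fin q) (Fin q) ℝ) :
    Matrix (Fin p) (Fin q) ℝ →ₗ[ℝ] Matrix (Fin p) (Fin q) ℝ where
  toFun x := L * x * R
  map_add' x y := by rw [Matrix.mul_add, Matrix.add_mul]
  map_smul' c x := by simp

/-- Pairs of orthoprojectors (symmetric idempotent matrices) of sizes `p × p` and `q × q`. -/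
abbrev ProjPair (p q : ℕ) : Type :=
  {L : Matrix (Fin p) (Fin p) ℝ // IsStarProjection L} ×
    {R : Matrix (Fin q) (Fin q) ℝ // IsStarProjection R}

/-- The low-rank sparsity structure on `p × q` matrices, with the nuclear norm. -/
def nuclearSparsity (p q : ℕ) : SparsityData (ProjPair p q) (Matrix (Fin p) (Fin q) ℝ) where
  norm := nuclearNorm
  P i := sandwich i.1.1 i.2.1
  Pbar i := sandwich (1 - i.1.1) (1 - i.2.1)
  weight i := ((max i.1.1.rank i.2.1.rank : ℕ) : ℝ)

end

/-!
Singular values enter through two facts about linear maps between Euclidean spaces.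

* Ky Fan's variational principle (`LinearMap.sum_inner_le_singularSum`,
  `LinearMap.exists_sum_inner_eq_singularSum`): the sum `Σ_k(T)` of the `k` largest singular values
  is the maximum of `∑ i, ⟪u i, T (v i)⟫` over pairs of `k`-element families satisfying Bessel's
  inequality. This makes `Σ_k` a seminorm. Orthogonal projectors carry Bessel families to Bessel
  families, and Bessel families in complementary subspaces may be joined, so that also
  `Σ_k(P T Q) + Σ_l((1 - P) T (1 - Q)) ≤ Σ_{k + l}(T)`.
* Weyl's inequality `σ_{i + r}(T) ≤ σ_i(T - B)` for `B` of rank at most `r`, which follows from a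
  dimension count.

A matrix `P z` with `P` of level `s` has rank at most `s`, hence `‖P z‖ ≤ Σ_s(P z) ≤ Σ_s(z)`; and
`z - Pbar z` has rank at most `2 s`, hence `‖z‖ - Σ_{2s}(z) ≤ ‖Pbar z‖`. Together these say that
`Σ_s + Σ_{2s}` dominates `‖P z‖ + ‖z‖ - ‖Pbar z‖`.

For the recovery statements, pinching in the form `‖P w‖ + ‖Pbar w‖ ≤ ‖w‖`, applied to `w = x + z`
with `x` close to `P x`, bounds `‖Pbar z‖ - ‖P z‖` by `‖x + z‖ - ‖x‖` up to `2 ‖x - P x‖`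
(`nuclearNorm_add_ge`). Near-optimality of `x + z` bounds `‖x + z‖ - ‖x‖` from above, and the
condition `C_s` turns this into a bound on `(1 - γ) ‖z‖`.
-/

open Module InnerProductSpace

section SingularValues

variable {E F ι κ : Type*} [NormedAddCommGroup E] [InnerProductSpace ℝ E]
  [NormedAddCommGroup F] [InnerProductSpace ℝ F] [Fintype ι] [Fintype κ]

/-! ### Bessel families -/

/-- A finite family of vectors satisfying Bessel's inequality. In contrast to orthonormal families,
these may contain zero vectors and are preserved by orthogonal projections. -/
def IsBessel (u : ι → E) : Prop := ∀ x, ∑ i, ⟪u i, x⟫_ℝ ^ 2 ≤ ‖x‖ ^ 2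

theorem IsBessel.norm_sq_le_one {u : ι → E} (hu : IsBessel u) (i : ι) : ‖u i‖ ^ 2 ≤ 1 := by
  have h := (Finset.single_le_sum (fun j _ => sq_nonneg ⟪u j, u i⟫_ℝ) (Finset.mem_univ i)).trans
    (hu (u i))
  rw [real_inner_self_eq_norm_sq] at h
  nlinarith [sq_nonneg ‖u i‖]

theorem isBessel_of_pairwise_orthogonal [DecidableEq ι] {u : ι → E} (d : ι → ℝ) (hd : ∀ i, d i ≤ 1)
    (h : ∀ i j, ⟪u i, u j⟫_ℝ = if i = j then d i else 0) : IsBessel u := by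
  intro x
  have h1 := sq_nonneg ‖x - ∑ i, ⟪u i, x⟫_ℝ • u i‖
  have h2 : ⟪x, ∑ i, ⟪u i, x⟫_ℝ • u i⟫_ℝ = ∑ i, ⟪u i, x⟫_ℝ ^ 2 := by
    rw [inner_sum]
    refine Finset.sum_congr rfl fun i _ => ?_
    rw [real_inner_smul_right, real_inner_comm, sq]
  have h3 : ‖∑ i, ⟪u i, x⟫_ℝ • u i‖ ^ 2 = ∑ i, ⟪u i, x⟫_ℝ ^ 2 * d i := by
    rw [← real_inner_self_eq_norm_sq, sum_inner]
    refine Finset.sum_congr rfl fun i _ => ?_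
    rw [inner_sum]
    simp only [real_inner_smul_left, real_inner_smul_right, h]
    simp [sq, mul_assoc]
  have h4 : ∑ i, ⟪u i, x⟫_ℝ ^ 2 * d i ≤ ∑ i, ⟪u i, x⟫_ℝ ^ 2 :=
    Finset.sum_le_sum fun i _ => mul_le_of_le_one_right (sq_nonneg _) (hd i)
  rw [norm_sub_sq_real, h2, h3] at h1
  linarith

theorem IsBessel.smul {u : ι → E} (hu : IsBessel u) {c : ℝ} (hc : c ^ 2 ≤ 1) :
    IsBessel fun i => c • u i := by
  intro x
  refine le_trans (Finset.sum_le_sum fun i _ => ?_) (hu x)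
  rw [real_inner_smul_left, mul_pow]
  exact mul_le_of_le_one_left (sq_nonneg _) hc

theorem IsBessel.sumElim_projection {P : E →ₗ[ℝ] E} (hP : P.IsSymmetricProjection)
    {u : ι → E} {v : κ → E} (hu : IsBessel u) (hv : IsBessel v) :
    IsBessel (Sum.elim (fun i => P (u i)) fun j => (LinearMap.id - P : E →ₗ[ℝ] E) (v j)) := by
  intro x
  have hPP : P (P x) = P x := LinearMap.congr_fun hP.isIdempotentElem x
  have h1 : ∀ i, ⟪P (u i), x⟫_ℝ = ⟪u i, P x⟫_ℝ := fun i => hP.isSymmetric _ _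
  have h2 : ∀ j, ⟪(LinearMap.id - P : E →ₗ[ℝ] E) (v j), x⟫_ℝ = ⟪v j, x - P x⟫_ℝ := fun j => by
    have : ⟪P (v j), x⟫_ℝ = ⟪v j, P x⟫_ℝ := hP.isSymmetric _ _
    simp [inner_sub_left, inner_sub_right, this]
  have h3 : ⟪P x, P x⟫_ℝ = ⟪x, P x⟫_ℝ := by
    rw [show ⟪P x, P x⟫_ℝ = ⟪x, P (P x)⟫_ℝ from hP.isSymmetric _ _, hPP]
  have h4 : ‖P x‖ ^ 2 + ‖x - P x‖ ^ 2 = ‖x‖ ^ 2 := by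
    rw [norm_sub_sq_real, ← real_inner_self_eq_norm_sq (P x), h3]
    ring
  rw [Fintype.sum_sum_type]
  simp only [Sum.elim_inl, Sum.elim_inr, h1, h2]
  linarith [hu (P x), hv (x - P x)]

/-! ### The variational principle of Ky Fan -/

/-- A nonnegative decreasing sequence, summed with weights from `[0, 1]` of total mass at most `k`,
gives at most the sum of its first `k` terms. -/
theorem Antitone.sum_mul_le_sum_range {a : ℕ → ℝ} (ha : Antitone a) (h0 : ∀ i, 0 ≤ a i) {n k : ℕ}
    {c : Fin n → ℝ} (hc : ∀ j, 0 ≤ c j) (hc1 : ∀ j, c j ≤ 1) (hk : ∑ j, c j ≤ k) :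
    ∑ j : Fin n, a j * c j ≤ ∑ i ∈ Finset.range k, a i := by
  -- Compare with the threshold `a k`: each term is at most `a k * c j + max (a j - a k) 0`.
  have h1 : ∀ j : Fin n, a j * c j ≤ a k * c j + if (j : ℕ) < k then a j - a k else 0 := by
    intro j
    split_ifs with h
    · nlinarith [ha h.le, hc1 j, hc j]
    · nlinarith [ha (not_lt.mp h), hc j]
  have h2 : ∑ j : Fin n, (if (j : ℕ) < k then a j - a k else 0)
      ≤ ∑ i ∈ Finset.range k, (a i - a k) := by
    rw [Fin.sum_univ_eq_sum_range (fun j => if j < k then a j - a k else 0) n,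
      ← Finset.sum_filter]
    refine Finset.sum_le_sum_of_subset_of_nonneg (fun j hj => ?_) fun i hi _ => ?_
    · simpa using (Finset.mem_filter.mp hj).2
    · exact sub_nonneg.mpr (ha (Finset.mem_range.mp hi).le)
  calc ∑ j : Fin n, a j * c j
      ≤ ∑ j : Fin n, (a k * c j + if (j : ℕ) < k then a j - a k else 0) :=
        Finset.sum_le_sum fun j _ => h1 j
    _ ≤ a k * k + ∑ i ∈ Finset.range k, (a i - a k) := by
        rw [Finset.sum_add_distrib, ← Finset.mul_sum]
        exact add_le_add (mul_le_mul_of_nonneg_left hk (h0 k)) h2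
    _ = ∑ i ∈ Finset.range k, a i := by simp [mul_comm]

namespace LinearMap

variable [FiniteDimensional ℝ E] [FiniteDimensional ℝ F] (T : E →ₗ[ℝ] F)

/-- The sum of the `k` largest singular values (the Ky Fan `k`-norm). -/
noncomputable def singularSum (k : ℕ) : ℝ := ∑ i ∈ Finset.range k, T.singularValues i

/-- An orthonormal basis of right singular vectors. -/
theorem exists_orthonormalBasis_inner_eq_sq_singularValues :
    ∃ b : OrthonormalBasis (Fin (finrank ℝ E)) ℝ E, ∀ i j,
      ⟪T (b i), T (b j)⟫_ℝ = if i = j then T.singularValues i ^ 2 else 0 := by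
  refine ⟨T.isSymmetric_adjoint_comp_self.eigenvectorBasis rfl, fun i j => ?_⟩
  set b := T.isSymmetric_adjoint_comp_self.eigenvectorBasis rfl with hb
  have h : T.adjoint (T (b j)) = T.singularValues j ^ 2 • b j := by
    rw [T.sq_singularValues_fin rfl]
    exact T.isSymmetric_adjoint_comp_self.apply_eigenvectorBasis rfl j
  rw [← LinearMap.adjoint_inner_right, h, real_inner_smul_right,
    orthonormal_iff_ite.mp b.orthonormal i j]
  split_ifs with hij
  · rw [hij, mul_one]
  · rw [mul_zero]

theorem exists_orthonormalBasis_norm_sq_apply :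
    ∃ b : OrthonormalBasis (Fin (finrank ℝ E)) ℝ E, ∀ x,
      ‖T x‖ ^ 2 = ∑ j : Fin (finrank ℝ E), T.singularValues j ^ 2 * ⟪b j, x⟫_ℝ ^ 2 := by
  obtain ⟨b, hb⟩ := T.exists_orthonormalBasis_inner_eq_sq_singularValues
  refine ⟨b, fun x => ?_⟩
  conv_lhs => rw [← b.sum_repr' x, map_sum, ← real_inner_self_eq_norm_sq, sum_inner]
  refine Finset.sum_congr rfl fun i _ => ?_
  rw [inner_sum]
  simp only [map_smul, real_inner_smul_left, real_inner_smul_right, hb]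
  simp
  ring

/-- The singular value decomposition. The left singular vectors `f j` belonging to the singular
value `0` are taken to be `0`. -/
theorem exists_singular_decomposition :
    ∃ (b : OrthonormalBasis (Fin (finrank ℝ E)) ℝ E) (f : Fin (finrank ℝ E) → F),
      IsBessel f ∧ (∀ j, T (b j) = T.singularValues j • f j) ∧
        (∀ i j, ⟪f i, T (b j)⟫_ℝ = if i = j then T.singularValues j else 0) ∧
        ∀ i j, i ≠ j → ⟪f i, f j⟫_ℝ = 0 := by
  obtain ⟨b, hb⟩ := T.exists_orthonormalBasis_inner_eq_sq_singularValues
  have hf : ∀ i j : Fin (finrank ℝ E), ⟪(T.singularValues i)⁻¹ • T (b i), (T.singularValues j)⁻¹ • T (b j)⟫_ℝ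
      = if i = j then (T.singularValues i)⁻¹ ^ 2 * T.singularValues i ^ 2 else 0 := by
    intro i j
    rw [real_inner_smul_left, real_inner_smul_right, hb]
    split_ifs with h
    · subst h; ring
    · ring
  refine ⟨b, fun j => (T.singularValues j)⁻¹ • T (b j),
    isBessel_of_pairwise_orthogonal _ (fun i => ?_) hf, fun j => ?_, fun i j => ?_, fun i j h => ?_⟩
  · by_cases h : T.singularValues i = 0
    · simp [h]
    · rw [← mul_pow, inv_mul_cancel₀ h, one_pow]
  · by_cases h : T.singularValues j = 0
    · have := hb j j
      rw [if_pos rfl, h, real_inner_self_eq_norm_sq] at this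
      have h0 : T (b j) = 0 := by simpa using this
      simp [h0]
    · rw [smul_smul, mul_inv_cancel₀ h, one_smul]
  · rw [real_inner_smul_left, hb]
    split_ifs with h
    · subst h
      by_cases h : T.singularValues i = 0
      · simp [h]
      · rw [sq, inv_mul_cancel_left₀ h]
    · rw [mul_zero]
  · rw [hf, if_neg h]

theorem sum_inner_le_singularSum {u : ι → F} {v : ι → E} (hu : IsBessel u) (hv : IsBessel v) :
    ∑ i, ⟪u i, T (v i)⟫_ℝ ≤ T.singularSum (Fintype.card ι) := by
  obtain ⟨b, f, hf, hTb, -, -⟩ := T.exists_singular_decomposition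
  -- The weight of `σ j` in the sum is at most `c j`, by the arithmetic-geometric mean inequality.
  set c : Fin (finrank ℝ E) → ℝ := fun j => ∑ i, (⟪b j, v i⟫_ℝ ^ 2 + ⟪u i, f j⟫_ℝ ^ 2) / 2 with hc
  have hexp : ∑ i, ⟪u i, T (v i)⟫_ℝ
      = ∑ j : Fin (finrank ℝ E), T.singularValues j * ∑ i, ⟪b j, v i⟫_ℝ * ⟪u i, f j⟫_ℝ := by
    simp only [Finset.mul_sum]
    rw [Finset.sum_comm]
    refine Finset.sum_congr rfl fun i _ => ?_
    conv_lhs => rw [← b.sum_repr' (v i), map_sum, inner_sum]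
    refine Finset.sum_congr rfl fun j _ => ?_
    rw [map_smul, hTb, real_inner_smul_right, real_inner_smul_right]
    ring
  rw [hexp]
  calc _ ≤ ∑ j : Fin (finrank ℝ E), T.singularValues j * c j := by
        refine Finset.sum_le_sum fun j _ =>
          mul_le_mul_of_nonneg_left (Finset.sum_le_sum fun i _ => ?_) (T.singularValues_nonneg j)
        nlinarith [sq_nonneg (⟪b j, v i⟫_ℝ - ⟪u i, f j⟫_ℝ)]
    _ ≤ _ := by
        refine T.singularValues_antitone.sum_mul_le_sum_range T.singularValues_nonneg
          (fun j => Finset.sum_nonneg fun i _ => by positivity) (fun j => ?_) ?_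
        · have h1 := hv (b j)
          have h2 := (hu (f j)).trans (hf.norm_sq_le_one j)
          simp only [real_inner_comm (b j), b.norm_eq_one] at h1
          rw [hc]
          dsimp only
          rw [← Finset.sum_div, Finset.sum_add_distrib]
          linarith
        · rw [hc, Finset.sum_comm]
          have : ∀ i, ∑ j, (⟪b j, v i⟫_ℝ ^ 2 + ⟪u i, f j⟫_ℝ ^ 2) / 2 ≤ 1 := by
            intro i
            have h1 := (b.sum_sq_inner_right (v i)).le.trans (hv.norm_sq_le_one i)
            have h2 := (hf (u i)).trans (hu.norm_sq_le_one i)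
            simp only [real_inner_comm (u i)] at h2
            rw [← Finset.sum_div, Finset.sum_add_distrib]
            linarith
          simpa using Finset.sum_le_sum fun i (_ : i ∈ Finset.univ) => this i

theorem exists_sum_inner_eq_singularSum (k : ℕ) :
    ∃ (u : Fin k → F) (v : Fin k → E), IsBessel u ∧ IsBessel v ∧
      ∑ i, ⟪u i, T (v i)⟫_ℝ = T.singularSum k := by
  obtain ⟨b, f, hf, -, hfT, hff⟩ := T.exists_singular_decomposition
  refine ⟨fun i => if h : (i : ℕ) < finrank ℝ E then f ⟨i, h⟩ else 0,
    fun i => if h : (i : ℕ) < finrank ℝ E then b ⟨i, h⟩ else 0,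
    isBessel_of_pairwise_orthogonal
      (fun i => if h : (i : ℕ) < finrank ℝ E then ‖f ⟨i, h⟩‖ ^ 2 else 0) (fun i => ?_)
      (fun i j => ?_),
    isBessel_of_pairwise_orthogonal
      (fun i => if (i : ℕ) < finrank ℝ E then 1 else 0) (fun i => ?_) (fun i j => ?_), ?_⟩
  · split_ifs
    · exact hf.norm_sq_le_one _
    · exact zero_le_one
  · by_cases hij : i = j
    · subst hij
      by_cases h : (i : ℕ) < finrank ℝ E <;> simp [h]
    · have : ∀ (hi : (i : ℕ) < finrank ℝ E) (hj : (j : ℕ) < finrank ℝ E),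
          ⟪f ⟨i, hi⟩, f ⟨j, hj⟩⟫_ℝ = 0 := fun hi hj =>
        hff _ _ fun h => hij (Fin.ext (by simpa using h))
      by_cases hi : (i : ℕ) < finrank ℝ E <;> by_cases hj : (j : ℕ) < finrank ℝ E <;>
        simp [hi, hj, hij, this]
  · split_ifs <;> norm_num
  · by_cases hi : (i : ℕ) < finrank ℝ E <;> by_cases hj : (j : ℕ) < finrank ℝ E <;>
      simp [hi, hj, b.inner_eq_ite, Fin.ext_iff]
    omega
  · rw [singularSum, ← Fin.sum_univ_eq_sum_range]
    refine Finset.sum_congr rfl fun i _ => ?_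
    by_cases h : (i : ℕ) < finrank ℝ E
    · simp [h, hfT]
    · simp [h, T.singularValues_of_finrank_le (not_lt.mp h)]

/-! ### Sums of singular values -/

theorem singularSum_mono : Monotone T.singularSum := fun _ _ h =>
  Finset.sum_le_sum_of_subset_of_nonneg (Finset.range_mono h) fun i _ _ => T.singularValues_nonneg i

theorem singularSum_nonneg (k : ℕ) : 0 ≤ T.singularSum k :=
  Finset.sum_nonneg fun i _ => T.singularValues_nonneg i

theorem singularSum_le_of_finrank_range_le {k : ℕ} (h : finrank ℝ T.range ≤ k) (l : ℕ) :
    T.singularSum l ≤ T.singularSum k := by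
  rcases le_total l k with hl | hl
  · exact T.singularSum_mono hl
  · refine (Finset.sum_subset (Finset.range_mono hl) fun i _ hi => ?_).ge
    exact T.singularValues_eq_zero_iff_le_finrank_range.mpr (h.trans (by simpa using hi))

theorem singularSum_add_le (S : E →ₗ[ℝ] F) (k : ℕ) :
    (T + S).singularSum k ≤ T.singularSum k + S.singularSum k := by
  obtain ⟨u, v, hu, hv, h⟩ := (T + S).exists_sum_inner_eq_singularSum k
  have hT := T.sum_inner_le_singularSum hu hv
  have hS := S.sum_inner_le_singularSum hu hv
  rw [Fintype.card_fin] at hT hS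
  rw [← h]
  simp only [add_apply, inner_add_right, Finset.sum_add_distrib]
  exact add_le_add hT hS

theorem singularSum_smul_le (r : ℝ) (k : ℕ) :
    (r • T).singularSum k ≤ |r| * T.singularSum k := by
  obtain ⟨u, v, hu, hv, h⟩ := (r • T).exists_sum_inner_eq_singularSum k
  -- The sign of `r` is absorbed into the family `u`.
  have hs : (SignType.sign r : ℝ) ^ 2 ≤ 1 := by
    rcases lt_trichotomy r 0 with hr | hr | hr <;> simp [hr]
  have hT := T.sum_inner_le_singularSum (hu.smul hs) hv
  rw [Fintype.card_fin] at hT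
  rw [← h]
  refine le_trans (le_of_eq ?_) (mul_le_mul_of_nonneg_left hT (abs_nonneg r))
  rw [Finset.mul_sum]
  refine Finset.sum_congr rfl fun i _ => ?_
  rw [smul_apply, real_inner_smul_right, real_inner_smul_left, ← mul_assoc, abs_mul_sign]

/-- Pinching: two complementary diagonal blocks of an operator have no larger singular sums than the
operator itself. -/
theorem singularSum_pinching_le {P : F →ₗ[ℝ] F} {Q : E →ₗ[ℝ] E} (hP : P.IsSymmetricProjection)
    (hQ : Q.IsSymmetricProjection) (k l : ℕ) :
    (P ∘ₗ T ∘ₗ Q).singularSum k + ((id - P) ∘ₗ T ∘ₗ (id - Q)).singularSum l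
      ≤ T.singularSum (k + l) := by
  obtain ⟨u, v, hu, hv, h⟩ := (P ∘ₗ T ∘ₗ Q).exists_sum_inner_eq_singularSum k
  obtain ⟨u', v', hu', hv', h'⟩ :=
    ((id - P) ∘ₗ T ∘ₗ (id - Q)).exists_sum_inner_eq_singularSum l
  have hT := T.sum_inner_le_singularSum (hu.sumElim_projection hP hu')
    (hv.sumElim_projection hQ hv')
  rw [Fintype.card_sum, Fintype.card_fin, Fintype.card_fin, Fintype.sum_sum_type] at hT
  refine le_trans (le_of_eq ?_) hT
  rw [← h, ← h']
  congr 1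
  · exact Finset.sum_congr rfl fun i _ => (hP.isSymmetric _ _).symm
  · refine Finset.sum_congr rfl fun i _ => ?_
    have hs : ∀ x y, ⟪P x, y⟫_ℝ = ⟪x, P y⟫_ℝ := hP.isSymmetric
    simp only [Sum.elim_inr, comp_apply, sub_apply, id_apply, inner_sub_left, inner_sub_right, hs]

/-! ### Weyl's inequality for perturbations of low rank -/

theorem singularValues_add_le_of_finrank_range_le {B : E →ₗ[ℝ] F} {r : ℕ}
    (hB : finrank ℝ B.range ≤ r) (i : ℕ) :
    T.singularValues (i + r) ≤ (T - B).singularValues i := by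
  rcases le_or_gt (finrank ℝ E) (i + r) with hn | hn
  · rw [T.singularValues_of_finrank_le hn]
    exact singularValues_nonneg _ _
  obtain ⟨b, hb⟩ := T.exists_orthonormalBasis_norm_sq_apply
  obtain ⟨b', hb'⟩ := (T - B).exists_orthonormalBasis_norm_sq_apply
  -- The common kernel of `B`, of the first `i` coordinates in the basis `b'` and of all but the
  -- first `i + r + 1` coordinates in the basis `b` is nonzero by a dimension count.
  let Φ : E →ₗ[ℝ] B.range × (Fin i → ℝ) × (Fin (finrank ℝ E - (i + r + 1)) → ℝ) :=
    B.rangeRestrict.prod ((LinearMap.pi fun j : Fin i => innerₛₗ ℝ (b' ⟨j, by omega⟩)).prod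
      (LinearMap.pi fun j : Fin (finrank ℝ E - (i + r + 1)) => innerₛₗ ℝ (b ⟨i + r + 1 + j, by omega⟩)))
  have hΦ : LinearMap.ker Φ ≠ ⊥ := by
    apply ker_ne_bot_of_finrank_lt
    rw [Module.finrank_prod, Module.finrank_prod, Module.finrank_fin_fun, Module.finrank_fin_fun]
    omega
  obtain ⟨x, hx, hx0⟩ := Submodule.exists_mem_ne_zero_of_ne_bot hΦ
  obtain ⟨hBx, hx1, hx2⟩ : B x = 0 ∧ (∀ j : Fin i, ⟪b' ⟨j, by omega⟩, x⟫_ℝ = 0) ∧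
      ∀ j : Fin (finrank ℝ E - (i + r + 1)), ⟪b ⟨i + r + 1 + j, by omega⟩, x⟫_ℝ = 0 := by
    have h : Φ x = 0 := hx
    simp only [Φ, Prod.ext_iff, funext_iff] at h
    exact ⟨congrArg Subtype.val h.1, h.2.1, h.2.2⟩
  have hlow : T.singularValues (i + r) ^ 2 * ‖x‖ ^ 2 ≤ ‖T x‖ ^ 2 := by
    rw [hb, ← b.sum_sq_inner_right x, Finset.mul_sum]
    refine Finset.sum_le_sum fun j _ => ?_
    by_cases hj : (j : ℕ) ≤ i + r
    · exact mul_le_mul_of_nonneg_right (pow_le_pow_left₀ (T.singularValues_nonneg _)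
        (T.singularValues_antitone hj) 2) (sq_nonneg _)
    · have h := hx2 ⟨j - (i + r + 1), by omega⟩
      have hj' : (⟨i + r + 1 + (j - (i + r + 1)), by omega⟩ : Fin (finrank ℝ E)) = j :=
        Fin.ext (by simp; omega)
      simp only [hj'] at h
      simp [h]
  have hup : ‖(T - B) x‖ ^ 2 ≤ (T - B).singularValues i ^ 2 * ‖x‖ ^ 2 := by
    rw [hb', ← b'.sum_sq_inner_right x, Finset.mul_sum]
    refine Finset.sum_le_sum fun j _ => ?_
    by_cases hj : (j : ℕ) < i
    · have h := hx1 ⟨j, hj⟩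
      simp only [Fin.eta] at h
      simp [h]
    · exact mul_le_mul_of_nonneg_right (pow_le_pow_left₀ (singularValues_nonneg _ _)
        (singularValues_antitone _ (not_lt.mp hj)) 2) (sq_nonneg _)
  rw [sub_apply, hBx, sub_zero] at hup
  have hpos : 0 < ‖x‖ ^ 2 := by positivity
  exact le_of_sq_le_sq (le_of_mul_le_mul_right (hlow.trans hup) hpos) (singularValues_nonneg _ _)

theorem singularSum_add_le_of_finrank_range_le {B : E →ₗ[ℝ] F} {r : ℕ}
    (hB : finrank ℝ B.range ≤ r) (k : ℕ) :
    T.singularSum (r + k) ≤ T.singularSum r + (T - B).singularSum k := by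
  rw [singularSum, Finset.sum_range_add]
  refine add_le_add le_rfl (Finset.sum_le_sum fun i _ => ?_)
  rw [add_comm]
  exact T.singularValues_add_le_of_finrank_range_le hB i

end LinearMap

end SingularValues

/-! ### Singular sums of matrices -/

section Matrices

variable {p q : ℕ}

theorem kyFan_eq_singularSum (k : ℕ) (z : Matrix (Fin p) (Fin q) ℝ) :
    kyFan k z = (Matrix.toEuclideanLin z).singularSum k := rfl

theorem nuclearNorm_eq_kyFan (z : Matrix (Fin p) (Fin q) ℝ) : nuclearNorm z = kyFan q z := rfl

theorem toEuclideanLin_isSymmetricProjection {n : ℕ} {L : Matrix (Fin n) (Fin n) ℝ}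
    (hL : IsStarProjection L) : (Matrix.toEuclideanLin L).IsSymmetricProjection where
  isIdempotentElem := by
    rw [IsIdempotentElem, Module.End.mul_eq_comp, ← Matrix.toLpLin_mul_same, hL.isIdempotentElem]
  isSymmetric := Matrix.isSymmetric_toEuclideanLin_iff.mpr hL.isSelfAdjoint

theorem finrank_range_toEuclideanLin (z : Matrix (Fin p) (Fin q) ℝ) :
    finrank ℝ (LinearMap.range (Matrix.toEuclideanLin z)) = z.rank := by
  rw [Matrix.toEuclideanLin_eq_toLin_orthonormal, ← Matrix.rank_eq_finrank_range_toLin]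

theorem matrix_rank_add_le (x y : Matrix (Fin p) (Fin q) ℝ) :
    (x + y).rank ≤ x.rank + y.rank := by
  rw [Matrix.rank, Matrix.rank, Matrix.rank, Matrix.mulVecLin_add]
  exact (Submodule.finrank_mono (LinearMap.range_add_le _ _)).trans
    (Submodule.finrank_add_le_finrank_add_finrank _ _)

theorem toEuclideanLin_sandwich (L : Matrix (Fin p) (Fin p) ℝ) (R : Matrix (Fin q) (Fin q) ℝ)
    (z : Matrix (Fin p) (Fin q) ℝ) :
    Matrix.toEuclideanLin (sandwich L R z) =
      Matrix.toEuclideanLin L ∘ₗ Matrix.toEuclideanLin z ∘ₗ Matrix.toEuclideanLin R := by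
  rw [← Matrix.toLpLin_mul_same, ← Matrix.toLpLin_mul_same, ← Matrix.mul_assoc]
  rfl

theorem kyFan_nonneg (k : ℕ) (z : Matrix (Fin p) (Fin q) ℝ) : 0 ≤ kyFan k z :=
  LinearMap.singularSum_nonneg _ k

theorem kyFan_le_nuclearNorm (k : ℕ) (z : Matrix (Fin p) (Fin q) ℝ) : kyFan k z ≤ nuclearNorm z :=
  LinearMap.singularSum_le_of_finrank_range_le _
    (by rw [finrank_range_toEuclideanLin]; exact z.rank_le_width) k

/-- The sum of the `k` largest singular values, as a seminorm. -/
noncomputable def kyFanSeminorm (p q k : ℕ) : Seminorm ℝ (Matrix (Fin p) (Fin q) ℝ) :=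
  Seminorm.ofSMulLE (kyFan k)
    (by simp [kyFan_eq_singularSum, LinearMap.singularSum])
    (fun x y => by
      simp only [kyFan_eq_singularSum, map_add]
      exact LinearMap.singularSum_add_le _ _ k)
    (fun r x => by
      simp only [kyFan_eq_singularSum, map_smul]
      exact LinearMap.singularSum_smul_le _ r k)

theorem nuclearNorm_eq_seminorm (z : Matrix (Fin p) (Fin q) ℝ) :
    nuclearNorm z = kyFanSeminorm p q q z := rfl

theorem eq_zero_of_kyFan_eq_zero {k : ℕ} (hk : 1 ≤ k) {z : Matrix (Fin p) (Fin q) ℝ}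
    (h : kyFan k z = 0) : z = 0 := by
  set T := Matrix.toEuclideanLin z with hT
  have h0 : T.singularValues 0 = 0 :=
    (Finset.sum_eq_zero_iff_of_nonneg fun i _ => T.singularValues_nonneg i).mp h 0
      (Finset.mem_range.mpr hk)
  have h1 : T = 0 := by
    rw [← T.singularValues_eq_zero_iff]
    ext i
    exact le_antisymm ((T.singularValues_antitone (Nat.zero_le i)).trans h0.le)
      (T.singularValues_nonneg i)
  exact (LinearEquiv.map_eq_zero_iff _).mp h1

theorem eq_zero_of_nuclearNorm_eq_zero {z : Matrix (Fin p) (Fin q) ℝ}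
    (h : nuclearNorm z = 0) : z = 0 :=
  eq_zero_of_kyFan_eq_zero le_rfl <|
    le_antisymm ((kyFan_le_nuclearNorm 1 z).trans h.le) (kyFan_nonneg 1 z)

theorem kyFan_pinching_le (i : ProjPair p q) (k l : ℕ) (z : Matrix (Fin p) (Fin q) ℝ) :
    kyFan k ((nuclearSparsity p q).P i z) + kyFan l ((nuclearSparsity p q).Pbar i z)
      ≤ kyFan (k + l) z := by
  have h := (Matrix.toEuclideanLin z).singularSum_pinching_le
    (toEuclideanLin_isSymmetricProjection i.1.2) (toEuclideanLin_isSymmetricProjection i.2.2) k l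
  simp only [kyFan_eq_singularSum, nuclearSparsity, toEuclideanLin_sandwich, map_sub]
  rwa [show Matrix.toEuclideanLin (1 : Matrix (Fin p) (Fin p) ℝ) = LinearMap.id from
      Matrix.toLpLin_one _, show Matrix.toEuclideanLin (1 : Matrix (Fin q) (Fin q) ℝ)
      = LinearMap.id from Matrix.toLpLin_one _]

theorem nuclearNorm_pinching_le (i : ProjPair p q) (z : Matrix (Fin p) (Fin q) ℝ) :
    nuclearNorm ((nuclearSparsity p q).P i z) + nuclearNorm ((nuclearSparsity p q).Pbar i z)
      ≤ nuclearNorm z :=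
  (kyFan_pinching_le i q q z).trans (kyFan_le_nuclearNorm _ z)

theorem Pbar_P_apply (i : ProjPair p q) (z : Matrix (Fin p) (Fin q) ℝ) :
    (nuclearSparsity p q).Pbar i ((nuclearSparsity p q).P i z) = 0 := by
  have h : (1 - i.1.1) * i.1.1 = 0 := by
    rw [sub_mul, one_mul, i.1.2.isIdempotentElem.eq, sub_self]
  change (1 - i.1.1) * (i.1.1 * z * i.2.1) * (1 - i.2.1) = 0
  rw [Matrix.mul_assoc i.1.1, ← Matrix.mul_assoc (1 - i.1.1), h, Matrix.zero_mul, Matrix.zero_mul]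

theorem mem_level_iff {s : ℕ} {i : ProjPair p q} :
    i ∈ (nuclearSparsity p q).level (s : ℝ) ↔ i.1.1.rank ≤ s ∧ i.2.1.rank ≤ s := by
  simp [SparsityData.level, nuclearSparsity]

theorem nuclearNorm_P_le {s : ℕ} {i : ProjPair p q}
    (hi : i ∈ (nuclearSparsity p q).level (s : ℝ)) (z : Matrix (Fin p) (Fin q) ℝ) :
    nuclearNorm ((nuclearSparsity p q).P i z) ≤ kyFan s z := by
  have hr : ((nuclearSparsity p q).P i z).rank ≤ s :=
    (Matrix.rank_mul_le_right (i.1.1 * z) i.2.1).trans (mem_level_iff.mp hi).2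
  calc nuclearNorm ((nuclearSparsity p q).P i z)
      ≤ kyFan s ((nuclearSparsity p q).P i z) :=
        LinearMap.singularSum_le_of_finrank_range_le _
          (by rw [finrank_range_toEuclideanLin]; exact hr) q
    _ ≤ kyFan s z := by
        have := kyFan_pinching_le i s 0 z
        simpa [kyFan] using this

/-- As `z - Pbar z` has rank at most `2 s`, the singular values of `z` beyond the first `2 s` are
bounded by those of `Pbar z`. -/
theorem nuclearNorm_sub_Pbar_le {s : ℕ} {i : ProjPair p q}
    (hi : i ∈ (nuclearSparsity p q).level (s : ℝ)) (z : Matrix (Fin p) (Fin q) ℝ) :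
    nuclearNorm z - nuclearNorm ((nuclearSparsity p q).Pbar i z) ≤ kyFan (2 * s) z := by
  obtain ⟨hL, hR⟩ := mem_level_iff.mp hi
  set B := z - (nuclearSparsity p q).Pbar i z with hB
  have hBeq : B = i.1.1 * z + (1 - i.1.1) * z * i.2.1 := by
    rw [hB]
    change z - (1 - i.1.1) * z * (1 - i.2.1) = _
    rw [Matrix.mul_sub, Matrix.mul_one, Matrix.sub_mul, Matrix.one_mul]
    abel
  have hrank : B.rank ≤ 2 * s := by
    rw [hBeq, two_mul]
    exact (matrix_rank_add_le _ _).trans (add_le_add ((Matrix.rank_mul_le_left _ _).trans hL)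
      ((Matrix.rank_mul_le_right _ _).trans hR))
  have h := (Matrix.toEuclideanLin z).singularSum_add_le_of_finrank_range_le
    (B := Matrix.toEuclideanLin B) (r := 2 * s)
    (by rw [finrank_range_toEuclideanLin]; exact hrank) q
  rw [← map_sub, hB, sub_sub_cancel] at h
  have h2 := (Matrix.toEuclideanLin z).singularSum_mono (Nat.le_add_left q (2 * s))
  simp only [nuclearNorm_eq_kyFan, kyFan_eq_singularSum]
  linarith

/-- The seminorm `Σ_s + Σ_{2s}` dominates the left-hand side of the condition `C_s`. -/
theorem dominates_kyFanSeminorm_add (p q s : ℕ) :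
    (nuclearSparsity p q).Dominates LinearMap.id (s : ℝ)
      (kyFanSeminorm p q s + kyFanSeminorm p q (2 * s)) := by
  intro z i hi
  have h1 := nuclearNorm_P_le hi z
  have h2 := nuclearNorm_sub_Pbar_le hi z
  change nuclearNorm ((nuclearSparsity p q).P i z) + nuclearNorm z
    - nuclearNorm ((nuclearSparsity p q).Pbar i z) ≤ kyFan s z + kyFan (2 * s) z
  linarith

/-- A lower bound on the nuclear norm of a perturbation `x + z` of a matrix `x` nearly fixed by the
projector `P`: by pinching, the part `Pbar z` cannot cancel against `P x`. -/
theorem nuclearNorm_add_ge (i : ProjPair p q) (x z : Matrix (Fin p) (Fin q) ℝ) :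
    nuclearNorm x + nuclearNorm ((nuclearSparsity p q).Pbar i z)
        - nuclearNorm ((nuclearSparsity p q).P i z)
        - 2 * nuclearNorm (x - (nuclearSparsity p q).P i x)
      ≤ nuclearNorm (x + z) := by
  set S := nuclearSparsity p q
  have h1 := nuclearNorm_pinching_le i (x + z)
  have h2 : nuclearNorm (S.P i x) ≤ nuclearNorm (S.P i (x + z)) + nuclearNorm (S.P i z) := by
    simpa [nuclearNorm_eq_seminorm] using
      map_sub_le_add (kyFanSeminorm p q q) (S.P i (x + z)) (S.P i z)
  have h3 : nuclearNorm (S.Pbar i z) ≤ nuclearNorm (S.Pbar i (x + z)) + nuclearNorm (S.Pbar i x) := by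
    simpa [nuclearNorm_eq_seminorm] using
      map_sub_le_add (kyFanSeminorm p q q) (S.Pbar i (x + z)) (S.Pbar i x)
  have h4 : nuclearNorm x ≤ nuclearNorm (x - S.P i x) + nuclearNorm (S.P i x) := by
    simpa [nuclearNorm_eq_seminorm] using
      map_add_le_add (kyFanSeminorm p q q) (x - S.P i x) (S.P i x)
  have h5 : nuclearNorm (S.Pbar i x) ≤ nuclearNorm (x - S.P i x) := by
    have h := nuclearNorm_pinching_le i (x - S.P i x)
    rw [map_sub (S.Pbar i), Pbar_P_apply, sub_zero] at h
    linarith [kyFan_nonneg q (S.P i (x - S.P i x)), nuclearNorm_eq_kyFan (S.P i (x - S.P i x))]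
  linarith

end Matrices

/-! ### Recovery by nuclear norm minimization -/

namespace SparsityData

theorem Bounded.mono {ι X E Y : Type*} [AddCommGroup X] [Module ℝ X] [AddCommGroup E] [Module ℝ E]
    [AddCommGroup Y] [Module ℝ Y] {S : SparsityData ι E} {A : X →ₗ[ℝ] Y} {B : X →ₗ[ℝ] E}
    {φ : Seminorm ℝ Y} {γ : ℝ} {β : ℝ≥0∞} {f g : X → ℝ} (hg : S.Bounded A B φ γ β g)
    (h : ∀ z, f z ≤ g z) : S.Bounded A B φ γ β f := fun z =>
  (EReal.coe_le_coe_iff.mpr (h z)).trans (hg z)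

theorem Bounded.le_of_eq_zero {ι X E Y : Type*} [AddCommGroup X] [Module ℝ X] [AddCommGroup E]
    [Module ℝ E] [AddCommGroup Y] [Module ℝ Y] {S : SparsityData ι E} {A : X →ₗ[ℝ] Y}
    {B : X →ₗ[ℝ] E} {φ : Seminorm ℝ Y} {γ : ℝ} {β : ℝ≥0∞} {f : X → ℝ}
    (hf : S.Bounded A B φ γ β f) {z : X} (hz : φ (A z) = 0) : f z ≤ γ * S.norm (B z) := by
  have h := hf z
  rw [hz, EReal.coe_zero, mul_zero, zero_add] at h
  exact EReal.coe_le_coe_iff.mp h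

theorem Bounded.le_of_ne_top {ι X E Y : Type*} [AddCommGroup X] [Module ℝ X] [AddCommGroup E]
    [Module ℝ E] [AddCommGroup Y] [Module ℝ Y] {S : SparsityData ι E} {A : X →ₗ[ℝ] Y}
    {B : X →ₗ[ℝ] E} {φ : Seminorm ℝ Y} {γ : ℝ} {β : ℝ≥0∞} {f : X → ℝ}
    (hf : S.Bounded A B φ γ β f) (hβ : β ≠ ∞) (z : X) :
    f z ≤ β.toReal * φ (A z) + γ * S.norm (B z) := by
  have h := hf z
  rw [← EReal.coe_ennreal_toReal hβ] at h
  exact_mod_cast h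

end SparsityData

section Recovery

variable {m p q : ℕ} {A : Matrix (Fin p) (Fin q) ℝ →ₗ[ℝ] EuclideanSpace ℝ (Fin m)}
  {φ : Seminorm ℝ (EuclideanSpace ℝ (Fin m))} {s : ℕ} {γ : ℝ} {β : ℝ≥0∞}

theorem isGood_of_cond (hγ : γ < 1)
    (hC : (nuclearSparsity p q).Cond A LinearMap.id φ (s : ℝ) γ β) :
    (nuclearSparsity p q).IsGood A LinearMap.id φ (s : ℝ) := by
  rintro x ⟨i, hi, hPx⟩
  simp only [LinearMap.id_apply] at hPx
  have hx : x ∈ SparsityData.feasible A φ 0 (A x) := by simp [SparsityData.feasible]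
  have key : ∀ u ∈ SparsityData.feasible A φ 0 (A x),
      nuclearNorm x + (1 - γ) * nuclearNorm (u - x) ≤ nuclearNorm u := by
    intro u hu
    have hz : φ (A (u - x)) = 0 := by
      rw [map_sub]
      exact le_antisymm hu (apply_nonneg _ _)
    have h1 : nuclearNorm ((nuclearSparsity p q).P i (u - x)) + nuclearNorm (u - x)
        - nuclearNorm ((nuclearSparsity p q).Pbar i (u - x)) ≤ γ * nuclearNorm (u - x) :=
      (hC i hi).le_of_eq_zero hz
    have h2 := nuclearNorm_add_ge i x (u - x)
    have h0 : nuclearNorm (0 : Matrix (Fin p) (Fin q) ℝ) = 0 := map_zero (kyFanSeminorm p q q)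
    rw [hPx, sub_self, h0, add_sub_cancel] at h2
    linarith
  have hmin : x ∈ (nuclearSparsity p q).regArgmin A LinearMap.id φ 0 (A x) := by
    refine ⟨hx, fun v hv => ?_⟩
    have h := key v hv
    have h' : 0 ≤ (1 - γ) * nuclearNorm (v - x) :=
      mul_nonneg (by linarith) (kyFan_nonneg q (v - x))
    change nuclearNorm x ≤ nuclearNorm v
    linarith
  refine Set.eq_singleton_iff_unique_mem.mpr ⟨⟨x, hmin, rfl⟩, ?_⟩
  rintro _ ⟨u, ⟨hu, hu'⟩, rfl⟩
  have h : nuclearNorm u ≤ nuclearNorm x := hu' x hx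
  have h' : nuclearNorm (u - x) ≤ 0 := by
    have := key u hu
    by_contra! hlt
    nlinarith [mul_pos (sub_pos.mpr hγ) hlt]
  exact sub_eq_zero.mp (eq_zero_of_nuclearNorm_eq_zero (le_antisymm h' (kyFan_nonneg q _)))

/-- The deterministic error bound behind both recovery procedures. -/
theorem one_sub_mul_nuclearNorm_sub_le (hβ : β ≠ ∞)
    (hC : (nuclearSparsity p q).Cond A LinearMap.id φ (s : ℝ) γ β)
    {x xhat : Matrix (Fin p) (Fin q) ℝ} {δx : ℝ}
    (hx : ∃ i ∈ (nuclearSparsity p q).level (s : ℝ),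
      nuclearNorm (x - (nuclearSparsity p q).P i x) ≤ δx) :
    (1 - γ) * nuclearNorm (xhat - x) ≤
      β.toReal * φ (A (xhat - x)) + (nuclearNorm xhat - nuclearNorm x) + 2 * δx := by
  obtain ⟨i, hi, hδ⟩ := hx
  have h1 : nuclearNorm ((nuclearSparsity p q).P i (xhat - x)) + nuclearNorm (xhat - x)
      - nuclearNorm ((nuclearSparsity p q).Pbar i (xhat - x)) ≤
      β.toReal * φ (A (xhat - x)) + γ * nuclearNorm (xhat - x) :=
    (hC i hi).le_of_ne_top hβ (xhat - x)
  have h2 := nuclearNorm_add_ge i x (xhat - x)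
  rw [add_sub_cancel] at h2
  linarith

theorem seminorm_map_sub_le (x xhat : Matrix (Fin p) (Fin q) ℝ)
    (ξ : EuclideanSpace ℝ (Fin m)) :
    φ (A (xhat - x)) ≤ φ (A xhat - (A x + ξ)) + φ ξ := by
  have h := map_add_le_add φ (A xhat - (A x + ξ)) ξ
  rwa [show A xhat - (A x + ξ) + ξ = A (xhat - x) by rw [map_sub]; abel] at h

theorem nuclearNorm_sub_le_of_regular_recovery (hγ : γ < 1) (hβ : β ≠ ∞)
    (hC : (nuclearSparsity p q).Cond A LinearMap.id φ (s : ℝ) γ β)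
    {x xhat : Matrix (Fin p) (Fin q) ℝ} {ξ : EuclideanSpace ℝ (Fin m)} {ε δx δφ δ : ℝ}
    (hξ : φ ξ ≤ ε)
    (hx : ∃ i ∈ (nuclearSparsity p q).level (s : ℝ),
      nuclearNorm (x - (nuclearSparsity p q).P i x) ≤ δx)
    (hfeas : φ (A xhat - (A x + ξ)) ≤ ε + δφ)
    (hopt : nuclearNorm xhat ≤
      (nuclearSparsity p q).regOpt A LinearMap.id φ ε (A x + ξ) + δ) :
    nuclearNorm (xhat - x) ≤ (β.toReal * (2 * ε + δφ) + δ + 2 * δx) / (1 - γ) := by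
  have h1 := one_sub_mul_nuclearNorm_sub_le (xhat := xhat) hβ hC hx
  have hreg : (nuclearSparsity p q).regOpt A LinearMap.id φ ε (A x + ξ) ≤ nuclearNorm x := by
    refine csInf_le ⟨0, ?_⟩ ⟨x, ?_, rfl⟩
    · rintro _ ⟨u, -, rfl⟩
      exact kyFan_nonneg q u
    · simpa [SparsityData.feasible] using hξ
  have h2 : β.toReal * φ (A (xhat - x)) ≤ β.toReal * (2 * ε + δφ) :=
    mul_le_mul_of_nonneg_left (by linarith [seminorm_map_sub_le (A := A) (φ := φ) x xhat ξ])
      ENNReal.toReal_nonneg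
  rw [le_div_iff₀ (by linarith)]
  linarith

theorem nuclearNorm_sub_le_of_penalized_recovery (hγ : γ < 1) (hβ : β ≠ ∞)
    (hC : (nuclearSparsity p q).Cond A LinearMap.id φ (s : ℝ) γ β) {lam : ℝ}
    (hβlam : β.toReal ≤ lam) {x xhat : Matrix (Fin p) (Fin q) ℝ}
    {ξ : EuclideanSpace ℝ (Fin m)} {δx δ : ℝ}
    (hx : ∃ i ∈ (nuclearSparsity p q).level (s : ℝ),
      nuclearNorm (x - (nuclearSparsity p q).P i x) ≤ δx)
    (hopt : lam * φ (A xhat - (A x + ξ)) + nuclearNorm xhat ≤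
      (nuclearSparsity p q).penOpt A LinearMap.id φ lam (A x + ξ) + δ) :
    nuclearNorm (xhat - x) ≤ (2 * δx + δ + 2 * lam * φ ξ) / (1 - γ) := by
  have hlam : 0 ≤ lam := ENNReal.toReal_nonneg.trans hβlam
  have h1 := one_sub_mul_nuclearNorm_sub_le (xhat := xhat) hβ hC hx
  have hpen : (nuclearSparsity p q).penOpt A LinearMap.id φ lam (A x + ξ)
      ≤ lam * φ ξ + nuclearNorm x := by
    refine (ciInf_le ⟨0, ?_⟩ x).trans (le_of_eq ?_)
    · rintro _ ⟨u, rfl⟩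
      exact add_nonneg (mul_nonneg hlam (apply_nonneg _ _)) (kyFan_nonneg q u)
    · rw [show A x - (A x + ξ) = -ξ by abel, map_neg_eq_map]
      rfl
  have h2 : β.toReal * φ (A (xhat - x)) ≤ lam * (φ (A xhat - (A x + ξ)) + φ ξ) :=
    mul_le_mul hβlam (seminorm_map_sub_le x xhat ξ) (apply_nonneg _ _) hlam
  rw [le_div_iff₀ (by linarith)]
  linarith

end Recovery

theorem proposition5 {m p q : ℕ} (hqp : q ≤ p)
    (A : Matrix (Fin p) (Fin q) ℝ →ₗ[ℝ] EuclideanSpace ℝ (Fin m))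
    (φ : Seminorm ℝ (EuclideanSpace ℝ (Fin m))) (hφ : ∀ v, φ v = 0 → v = 0) (s : ℕ) :
    -- `Σ_s + Σ_{2s}` is a seminorm, a norm if `s ≥ 1`, and satisfies the domination condition
    (∃ N : Seminorm ℝ (Matrix (Fin p) (Fin q) ℝ),
      (∀ z, N z = kyFan s z + kyFan (2 * s) z) ∧
      (1 ≤ s → ∀ z, N z = 0 → z = 0) ∧
      (nuclearSparsity p q).Dominates LinearMap.id (s : ℝ) N) ∧
    ∀ (γ : ℝ) (β : ℝ≥0∞), 0 ≤ γ →
      (nuclearSparsity p q).Bounded A LinearMap.id φ γ β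
        (fun z => kyFan s z + kyFan (2 * s) z) →
      (nuclearSparsity p q).CondPlus A LinearMap.id φ (s : ℝ) γ β ∧
      (nuclearSparsity p q).Cond A LinearMap.id φ (s : ℝ) γ β ∧
      (γ < 1 →
        (nuclearSparsity p q).IsGood A LinearMap.id φ (s : ℝ) ∧
        (β ≠ ∞ →
          -- error bound for the regular recovery
          (∀ (x xhat : Matrix (Fin p) (Fin q) ℝ) (ξ : EuclideanSpace ℝ (Fin m))
            (ε δx δφ δ : ℝ), 0 ≤ δx → 0 ≤ δφ → 0 ≤ δ →
            φ ξ ≤ ε →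
            (∃ i ∈ (nuclearSparsity p q).level (s : ℝ),
              nuclearNorm (x - (nuclearSparsity p q).P i x) ≤ δx) →
            φ (A xhat - (A x + ξ)) ≤ ε + δφ →
            nuclearNorm xhat ≤
              (nuclearSparsity p q).regOpt A LinearMap.id φ ε (A x + ξ) + δ →
            nuclearNorm (xhat - x) ≤
              (β.toReal * (2 * ε + δφ) + δ + 2 * δx) / (1 - γ)) ∧
          -- error bound for the penalized recovery
          (∀ (lam : ℝ), 0 < lam → β.toReal ≤ lam →
            ∀ (x xhat : Matrix (Fin p) (Fin q) ℝ) (ξ : EuclideanSpace ℝ (Fin m)) (δx δ : ℝ),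
            (∃ i ∈ (nuclearSparsity p q).level (s : ℝ),
              nuclearNorm (x - (nuclearSparsity p q).P i x) ≤ δx) →
            lam * φ (A xhat - (A x + ξ)) + nuclearNorm xhat ≤
              (nuclearSparsity p q).penOpt A LinearMap.id φ lam (A x + ξ) + δ →
            nuclearNorm (xhat - x) ≤ (2 * δx + δ + 2 * lam * φ ξ) / (1 - γ)))) := by
  have hdom := dominates_kyFanSeminorm_add p q s
  refine ⟨⟨kyFanSeminorm p q s + kyFanSeminorm p q (2 * s), fun z => rfl, fun hs z hz => ?_, hdom⟩,
    fun γ β _ hb => ?_⟩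
  · have hz' : kyFan s z + kyFan (2 * s) z = 0 := hz
    exact eq_zero_of_kyFan_eq_zero hs
      (by linarith [kyFan_nonneg s z, kyFan_nonneg (2 * s) z])
  have hC : (nuclearSparsity p q).Cond A LinearMap.id φ (s : ℝ) γ β := fun i hi =>
    hb.mono fun z => hdom z i hi
  refine ⟨⟨_, hdom, hb⟩, hC, fun hγ => ⟨isGood_of_cond hγ hC, fun hβ => ⟨?_, ?_⟩⟩⟩
  · intro x xhat ξ ε δx δφ δ _ _ _ hξ hx hfeas hopt
    exact nuclearNorm_sub_le_of_regular_recovery hγ hβ hC hξ hx hfeas hopt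
  · intro lam _ hβlam x xhat ξ δx δ hx hopt
    exact nuclearNorm_sub_le_of_penalized_recovery hγ hβ hC hβlam hx hopt
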